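/- A turn sequence is a finite (possibly empty) word $\sigma=\sigma_1\cdots\sigma_n$ with $\sigma_i\in\{\mathtt{L},\mathtt{R}\}$. A rectilinear chain realizes $\sigma$ if it is simple (it has no self-intersection), consists of $n+1$ axis-parallel segments of positive integral lengths, starts at the origin with its first segment heading east, and makes at its successive bends the left ($\mathtt{L}$) and right ($\mathtt{R}$) turns by $90^\circ$ prescribed by $\sigma_1,\dots,\sigma_n$ in this order. Let $A(\sigma)\subseteq\mathbb{Z}^2$ be the set of the endpoints of all chains that realize $\sigma$. Call a set $S\subseteq\mathbb{Z}^2$ connected if it is non-empty and any two points of $S$ can be joined by a path of unit horizontal and vertical steps between lattice points that stays in $S$. Theorem. For every turn sequence $\sigma$, the reachable set $A(\sigma)$ and the unreachable set $\mathbb{Z}^2\setminus A(\sigma)$ are both connected. -/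

import Mathlib

/-- A turn of a rectilinear chain: left (by `+90°`) or right (by `-90°`). -/
inductive Turn where
  | L : Turn
  | R : Turn

/-- The direction of travel after a turn, if `d` is the direction before it. -/
def Turn.apply : Turn → ℤ × ℤ → ℤ × ℤ
  | Turn.L, d => (-d.2, d.1)
  | Turn.R, d => (d.2, -d.1)

/-- The direction of the segment number `i` (counted from `0`) of a chain that starts to the east
and makes the turns of `σ` in order. -/
def heading (σ : List Turn) (i : ℕ) : ℤ × ℤ :=
  (σ.take i).foldl (fun d t => t.apply d) (1, 0)

/-- The vertex number `i` of the chain from the origin with turn sequence `σ` whose segment number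
`j` has length `ℓ j`. The vertex `0` is the origin, the vertices `1, …, σ.length` are the bends, and
the vertex `σ.length + 1` is the endpoint. -/
def chainVertex (σ : List Turn) (ℓ : ℕ → ℕ) (i : ℕ) : ℤ × ℤ :=
  ∑ j ∈ Finset.range i, ℓ j • heading σ j

/-- The lattice points on the segment number `i`, from vertex `i` to vertex `i + 1`. These two
vertices differ in one coordinate only, so the box that they span is the segment. -/
def chainSegment (σ : List Turn) (ℓ : ℕ → ℕ) (i : ℕ) : Set (ℤ × ℤ) :=
  Set.uIcc (chainVertex σ ℓ i) (chainVertex σ ℓ (i + 1))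

/-- The segment lengths `ℓ 0, …, ℓ σ.length` give a simple rectilinear chain that realizes `σ`: they
are positive, and two different segments meet only if they are consecutive, and then only in their
common vertex. (Axis-parallel segments with integral endpoints that meet in the plane have a common
lattice point, and all their common points are lattice points unless they overlap in a segment, so
that it is enough to look at lattice points.) -/
def Realizes (σ : List Turn) (ℓ : ℕ → ℕ) : Prop :=
  (∀ i ≤ σ.length, 0 < ℓ i) ∧
    ∀ i j, i < j → j ≤ σ.length → ∀ q, q ∈ chainSegment σ ℓ i → q ∈ chainSegment σ ℓ j →
      j = i + 1 ∧ q = chainVertex σ ℓ j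

/-- `A(σ)`: the endpoints of the simple rectilinear chains that realize `σ`. -/
def reachableSet (σ : List Turn) : Set (ℤ × ℤ) :=
  {p | ∃ ℓ : ℕ → ℕ, Realizes σ ℓ ∧ chainVertex σ ℓ (σ.length + 1) = p}

/-- The square grid: lattice points are adjacent if they are at distance one. -/
def gridGraph : SimpleGraph (ℤ × ℤ) where
  Adj p q := |p.1 - q.1| + |p.2 - q.2| = 1
  symm := ⟨fun p q h => by rw [abs_sub_comm q.1, abs_sub_comm q.2]; exact h⟩
  loopless := ⟨fun p h => by simp at h⟩

/-- A set of lattice points is connected if it is non-empty and any two of its points are joined by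
a path in the square grid that stays in the set. -/
def GridConnected (S : Set (ℤ × ℤ)) : Prop :=
  (gridGraph.induce S).Connected

/-!
Two deformations of chains carry the proof.

A chain with at least one bend can be cut along a staircase that crosses none of its vertical edges,
and opened by one step to the right. If the endpoint does not lie to the left of the origin, the
staircase can be chosen to pass between the origin and the endpoint. By symmetry, an endpoint can
therefore be moved one step in any direction that leads away from the origin: if it lies in the box
spanned by the origin and `q`, then `q` is an endpoint as well. Hence the box spanned by the origin
and an unreachable point is unreachable, and the unreachable set is connected.

For the reachable set, induct on the number of bends. Let `d` be the direction of the last segment.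
Doubling a chain and appending a unit segment sends an endpoint `q` to the endpoint `2q + d` of a
chain with one more bend. Every endpoint is joined to one of this form: shorten its last segment to
length one and move outwards from there. Moreover, images of neighbours `p` and `q` are joined by
moving outwards, either from one image to the other or, if `q = p - d` with `p` on the line through
the origin perpendicular to `d`, from `p`, which is then itself an endpoint for one more bend.
-/

section GridGeometry

/-- The `ℓ¹` norm on `ℤ × ℤ`. Adjacency and axis-parallel boxes are expressed through it, so that
its linear isometries preserve both. -/
def gridNorm (p : ℤ × ℤ) : ℕ := p.1.natAbs + p.2.natAbs

theorem gridNorm_eq_one_iff {d : ℤ × ℤ} :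
    gridNorm d = 1 ↔ d = (1, 0) ∨ d = (-1, 0) ∨ d = (0, 1) ∨ d = (0, -1) := by
  simp only [gridNorm, Prod.ext_iff]
  omega

theorem gridGraph_adj_iff {p q : ℤ × ℤ} : gridGraph.Adj p q ↔ gridNorm (q - p) = 1 := by
  simp only [gridGraph, gridNorm, Prod.fst_sub, Prod.snd_sub, ← Int.natCast_natAbs]
  omega

theorem mem_uIcc_iff_coord {a b q : ℤ × ℤ} :
    q ∈ Set.uIcc a b ↔ (min a.1 b.1 ≤ q.1 ∧ q.1 ≤ max a.1 b.1) ∧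
      (min a.2 b.2 ≤ q.2 ∧ q.2 ≤ max a.2 b.2) := by
  rw [Set.uIcc_prod_eq]
  rfl

theorem mem_uIcc_iff_gridNorm {a b q : ℤ × ℤ} :
    q ∈ Set.uIcc a b ↔ gridNorm (q - a) + gridNorm (b - q) = gridNorm (b - a) := by
  simp only [mem_uIcc_iff_coord, gridNorm, Prod.fst_sub, Prod.snd_sub]
  omega

theorem exists_mem_uIcc_adj_gridNorm_lt {a b : ℤ × ℤ} (hab : a ≠ b) :
    ∃ c ∈ Set.uIcc a b, gridGraph.Adj c b ∧ gridNorm (c - a) < gridNorm (b - a) := by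
  have hab' : a.1 ≠ b.1 ∨ a.2 ≠ b.2 := by rwa [← not_and_or, ← Prod.ext_iff]
  simp only [mem_uIcc_iff_coord, gridGraph_adj_iff, gridNorm, Prod.fst_sub, Prod.snd_sub,
    Prod.exists]
  rcases hab' with h1 | h2
  · exact ⟨b.1 - (b.1 - a.1).sign, b.2, by
      rcases h1.lt_or_gt with h | h
      · rw [Int.sign_eq_one_of_pos (sub_pos.2 h)]; omega
      · rw [Int.sign_eq_neg_one_of_neg (sub_neg.2 h)]; omega⟩
  · exact ⟨b.1, b.2 - (b.2 - a.2).sign, by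
      rcases h2.lt_or_gt with h | h
      · rw [Int.sign_eq_one_of_pos (sub_pos.2 h)]; omega
      · rw [Int.sign_eq_neg_one_of_neg (sub_neg.2 h)]; omega⟩

theorem uIcc_grid_induction {P : ℤ × ℤ → Prop} {a b : ℤ × ℤ} (base : P a)
    (step : ∀ c d, c ∈ Set.uIcc a d → d ∈ Set.uIcc a b → gridGraph.Adj c d → P c → P d) : P b := by
  induction hk : gridNorm (b - a) using Nat.strong_induction_on generalizing b with
  | _ k ih =>
    obtain rfl | hab := eq_or_ne a b
    · exact base
    obtain ⟨c, hc, hadj, hlt⟩ := exists_mem_uIcc_adj_gridNorm_lt hab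
    have hPc : P c := ih _ (hk ▸ hlt)
      (fun e d he hd => step e d he (Set.uIcc_subset_uIcc_left hc hd)) rfl
    exact step c b hc Set.right_mem_uIcc hadj hPc

/-- Two points of `S` are joined by a grid path that stays in `S`. -/
def GridJoinedIn (S : Set (ℤ × ℤ)) (a b : ℤ × ℤ) : Prop :=
  ∃ (ha : a ∈ S) (hb : b ∈ S), (gridGraph.induce S).Reachable ⟨a, ha⟩ ⟨b, hb⟩

namespace GridJoinedIn

variable {S T : Set (ℤ × ℤ)} {a b c : ℤ × ℤ}

theorem refl (ha : a ∈ S) : GridJoinedIn S a a := ⟨ha, ha, .rfl⟩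

theorem symm : GridJoinedIn S a b → GridJoinedIn S b a
  | ⟨ha, hb, hab⟩ => ⟨hb, ha, hab.symm⟩

theorem trans : GridJoinedIn S a b → GridJoinedIn S b c → GridJoinedIn S a c
  | ⟨ha, _, hab⟩, ⟨_, hc, hbc⟩ => ⟨ha, hc, hab.trans hbc⟩

theorem of_adj (ha : a ∈ S) (hb : b ∈ S) (hab : gridGraph.Adj a b) : GridJoinedIn S a b :=
  ⟨ha, hb, SimpleGraph.Adj.reachable (G := gridGraph.induce S) hab⟩

theorem of_uIcc_subset (hS : Set.uIcc a b ⊆ S) : GridJoinedIn S a b :=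
  uIcc_grid_induction (refl (hS Set.left_mem_uIcc)) fun _ _ hcd hd hadj hac =>
    hac.trans (of_adj (hS (Set.uIcc_subset_uIcc_left hd hcd)) (hS hd) hadj)

theorem map {f : ℤ × ℤ → ℤ × ℤ} (hf : Set.MapsTo f S T)
    (hadj : ∀ p ∈ S, ∀ q ∈ S, gridGraph.Adj p q → GridJoinedIn T (f p) (f q))
    (hab : GridJoinedIn S a b) : GridJoinedIn T (f a) (f b) := by
  suffices ∀ x y : S, (gridGraph.induce S).Walk x y → GridJoinedIn T (f x) (f y) by
    obtain ⟨ha, hb, ⟨w⟩⟩ := hab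
    exact this _ _ w
  intro x y w
  induction w with
  | @nil x => exact refl (hf x.2)
  | @cons x z y hxz _ ih => exact (hadj x x.2 z z.2 hxz).trans ih

end GridJoinedIn

theorem gridConnected_iff_exists_gridJoinedIn {S : Set (ℤ × ℤ)} :
    GridConnected S ↔ ∃ o ∈ S, ∀ p ∈ S, GridJoinedIn S o p := by
  rw [GridConnected, SimpleGraph.connected_iff_exists_forall_reachable]
  exact ⟨fun ⟨o, ho⟩ => ⟨o, o.2, fun p hp => ⟨o.2, hp, ho ⟨p, hp⟩⟩⟩,
    fun ⟨o, ho, hS⟩ => ⟨⟨o, ho⟩, fun p => (hS p p.2).2.2⟩⟩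

end GridGeometry

section Isometries

/-- The symmetries of the grid that fix the origin: linear isometries for `gridNorm`. -/
def IsGridIsometry (g : ℤ × ℤ ≃+ ℤ × ℤ) : Prop := ∀ p, gridNorm (g p) = gridNorm p

theorem IsGridIsometry.symm {g : ℤ × ℤ ≃+ ℤ × ℤ} (hg : IsGridIsometry g) :
    IsGridIsometry g.symm := fun p => by rw [← hg, g.apply_symm_apply]

theorem IsGridIsometry.map_mem_uIcc_iff {g : ℤ × ℤ ≃+ ℤ × ℤ} (hg : IsGridIsometry g)
    {a b q : ℤ × ℤ} : g q ∈ Set.uIcc (g a) (g b) ↔ q ∈ Set.uIcc a b := by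
  simp only [mem_uIcc_iff_gridNorm, ← map_sub, hg _]

theorem isGridIsometry_units_smul (u w : ℤˣ) :
    IsGridIsometry ((DistribMulAction.toAddEquiv ℤ u).prodCongr
      (DistribMulAction.toAddEquiv ℤ w)) := fun p => by
  change (u • p.1).natAbs + (w • p.2).natAbs = _
  simp [gridNorm, Units.smul_def, Int.natAbs_mul]

theorem exists_isGridIsometry_map_eq_east {d : ℤ × ℤ} (hd : gridNorm d = 1) (p : ℤ × ℤ) :
    ∃ g, IsGridIsometry g ∧ g d = (1, 0) ∧ 0 ≤ (g p).2 := by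
  have exists_sign (x : ℤ) : ∃ w : ℤˣ, 0 ≤ w • x := by
    rcases le_total 0 x with hx | hx
    · exact ⟨1, by simpa⟩
    · exact ⟨-1, by simpa [Units.smul_def]⟩
  have exists_unit (x : ℤ) (hx : x.natAbs = 1) : ∃ u : ℤˣ, u • x = 1 := by
    rcases Int.natAbs_eq_iff.1 hx with rfl | rfl
    · exact ⟨1, by simp⟩
    · exact ⟨-1, by simp [Units.smul_def]⟩
  obtain ⟨x, y⟩ := d
  have hd' : (x.natAbs = 1 ∧ y = 0) ∨ (x = 0 ∧ y.natAbs = 1) := by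
    simp only [gridNorm] at hd
    omega
  rcases hd' with ⟨hx, rfl⟩ | ⟨rfl, hy⟩
  · obtain ⟨u, hu⟩ := exists_unit x hx
    obtain ⟨w, hw⟩ := exists_sign p.2
    exact ⟨_, isGridIsometry_units_smul u w, Prod.ext hu (smul_zero w), hw⟩
  · obtain ⟨u, hu⟩ := exists_unit y hy
    obtain ⟨w, hw⟩ := exists_sign p.1
    let g := (DistribMulAction.toAddEquiv ℤ u).prodCongr (DistribMulAction.toAddEquiv ℤ w)
    exact ⟨AddEquiv.prodComm.trans g, fun q =>
      (isGridIsometry_units_smul u w _).trans (add_comm _ _), Prod.ext hu (smul_zero w), hw⟩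

end Isometries

section Headings

/-- The point `b` is reached from `a` by a segment of positive length with direction `d`. -/
def Ahead (d a b : ℤ × ℤ) : Prop := ∃ l : ℕ, 0 < l ∧ b = a + l • d

-- Stated without `l • d`, so that linear arithmetic can use it.
theorem ahead_iff_lt {d a b : ℤ × ℤ} (hd : gridNorm d = 1) :
    Ahead d a b ↔ ((0 < d.1 ↔ a.1 < b.1) ∧ (d.1 < 0 ↔ b.1 < a.1)) ∧
      ((0 < d.2 ↔ a.2 < b.2) ∧ (d.2 < 0 ↔ b.2 < a.2)) := by
  rcases gridNorm_eq_one_iff.1 hd with rfl | rfl | rfl | rfl <;>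
    simp only [Ahead, Prod.ext_iff, Prod.fst_add, Prod.snd_add, Prod.smul_mk, nsmul_eq_mul] <;>
    refine ⟨fun ⟨l, _, h1, h2⟩ => ?_, fun h => ⟨gridNorm (b - a), ?_⟩⟩ <;>
    simp only [gridNorm, Prod.fst_sub, Prod.snd_sub] at * <;> omega

theorem Ahead.map {d a b : ℤ × ℤ} (g : ℤ × ℤ ≃+ ℤ × ℤ) :
    Ahead d a b → Ahead (g d) (g a) (g b) := by
  rintro ⟨l, hl, rfl⟩
  exact ⟨l, hl, by rw [map_add, map_nsmul]⟩

/-- The directions `h 0, …, h n` are unit vectors and each is a quarter turn away from the one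
before. They replace the turn sequence because, unlike words that start to the east, they can be
moved by grid isometries. -/
structure IsHeadingSeq (h : ℕ → ℤ × ℤ) (n : ℕ) : Prop where
  unit : ∀ i ≤ n, gridNorm (h i) = 1
  turn : ∀ i < n, h (i + 1) ≠ h i ∧ h (i + 1) ≠ -h i

namespace IsHeadingSeq

variable {h : ℕ → ℤ × ℤ} {n : ℕ}

theorem fst_eq_zero_iff (H : IsHeadingSeq h n) {i : ℕ} (hi : i < n) :
    (h i).1 = 0 ↔ (h (i + 1)).1 ≠ 0 := by
  have hu := H.unit i hi.le
  have hu' := H.unit (i + 1) hi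
  have ht := H.turn i hi
  simp only [gridNorm, ne_eq, Prod.ext_iff, Prod.fst_neg, Prod.snd_neg] at *
  omega

theorem of_succ (H : IsHeadingSeq h (n + 1)) : IsHeadingSeq h n :=
  ⟨fun i hi => H.unit i (by omega), fun i hi => H.turn i (by omega)⟩

theorem map (H : IsHeadingSeq h n) {g : ℤ × ℤ ≃+ ℤ × ℤ} (hg : IsGridIsometry g) :
    IsHeadingSeq (g ∘ h) n :=
  ⟨fun i hi => (hg _).trans (H.unit i hi), fun i hi => by
    simpa only [Function.comp_apply, ← map_neg, ne_eq, g.injective.eq_iff] using H.turn i hi⟩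

end IsHeadingSeq

end Headings

section Chains

/-- The lattice points on the segment from vertex `i` to vertex `i + 1`. -/
def edge (v : ℕ → ℤ × ℤ) (i : ℕ) : Set (ℤ × ℤ) := Set.uIcc (v i) (v (i + 1))

/-- The vertices `v 0 = 0, …, v (n + 1)` form a simple chain with headings `h 0, …, h n`. Chains are
described by their vertices instead of their lengths because the deformations used below act on
points of the plane. -/
structure IsSimpleChain (h : ℕ → ℤ × ℤ) (n : ℕ) (v : ℕ → ℤ × ℤ) : Prop where
  zero : v 0 = 0
  ahead : ∀ i ≤ n, Ahead (h i) (v i) (v (i + 1))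
  simple : ∀ i j, i < j → j ≤ n → ∀ q, q ∈ edge v i → q ∈ edge v j → j = i + 1 ∧ q = v j

/-- The endpoints of the simple chains with headings `h 0, …, h n`. -/
def chainEnds (h : ℕ → ℤ × ℤ) (n : ℕ) : Set (ℤ × ℤ) :=
  {p | ∃ v, IsSimpleChain h n v ∧ v (n + 1) = p}

variable {h v : ℕ → ℤ × ℤ} {n : ℕ} {p q : ℤ × ℤ}

theorem mem_edge {i : ℕ} :
    q ∈ edge v i ↔ (min (v i).1 (v (i + 1)).1 ≤ q.1 ∧ q.1 ≤ max (v i).1 (v (i + 1)).1) ∧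
      (min (v i).2 (v (i + 1)).2 ≤ q.2 ∧ q.2 ≤ max (v i).2 (v (i + 1)).2) :=
  mem_uIcc_iff_coord

theorem edge_update_of_lt {i : ℕ} (hi : i < n) :
    edge (Function.update v (n + 1) p) i = edge v i := by
  rw [edge, Function.update_of_ne (by omega), Function.update_of_ne (by omega), edge]

theorem edge_update_self : edge (Function.update v (n + 1) p) n = Set.uIcc (v n) p := by
  rw [edge, Function.update_of_ne (by omega), Function.update_self]

namespace IsSimpleChain

theorem of_disjoint (H : IsHeadingSeq h n) (zero : v 0 = 0)
    (ahead : ∀ i ≤ n, Ahead (h i) (v i) (v (i + 1)))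
    (disj : ∀ i j, i + 1 < j → j ≤ n → Disjoint (edge v i) (edge v j)) : IsSimpleChain h n v := by
  refine ⟨zero, ahead, fun i j hij hj q hi hq => ?_⟩
  obtain rfl | hlt := (Nat.succ_le_of_lt hij).eq_or_lt
  · have hi1 := H.unit i (by omega)
    have hj1 := H.unit (i + 1) hj
    have ht := H.fst_eq_zero_iff (i := i) (by omega)
    have ai := (ahead_iff_lt hi1).1 (ahead i (by omega))
    have aj := (ahead_iff_lt hj1).1 (ahead (i + 1) hj)
    rw [mem_edge] at hi hq
    refine ⟨rfl, ?_⟩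
    simp only [gridNorm, Nat.succ_eq_add_one, Prod.ext_iff] at *
    omega
  · exact (Set.disjoint_left.1 (disj i j hlt hj) hi hq).elim

theorem of_mapsTo_edge {w : ℕ → ℤ × ℤ} (C : IsSimpleChain h n v) (H : IsHeadingSeq h n)
    (zero : w 0 = 0) (ahead : ∀ i ≤ n, Ahead (h i) (w i) (w (i + 1))) (r : ℤ × ℤ → ℤ × ℤ)
    (hr : ∀ i ≤ n, Set.MapsTo r (edge w i) (edge v i)) : IsSimpleChain h n w := by
  refine .of_disjoint H zero ahead fun i j hij hj => Set.disjoint_left.2 fun q hi hq => ?_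
  have := (C.simple i j (by omega) hj _ (hr i (by omega) hi) (hr j hj hq)).1
  omega

theorem of_succ (C : IsSimpleChain h (n + 1) v) : IsSimpleChain h n v :=
  ⟨C.zero, fun i hi => C.ahead i (by omega), fun i j hij hj => C.simple i j hij (by omega)⟩

theorem map (C : IsSimpleChain h n v) {g : ℤ × ℤ ≃+ ℤ × ℤ} (hg : IsGridIsometry g) :
    IsSimpleChain (g ∘ h) n (g ∘ v) := by
  have mem_edge_map (i : ℕ) (q : ℤ × ℤ) : q ∈ edge (g ∘ v) i ↔ g.symm q ∈ edge v i := by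
    obtain ⟨q, rfl⟩ := g.surjective q
    rw [g.symm_apply_apply]
    exact hg.map_mem_uIcc_iff
  refine ⟨by simp [C.zero], fun i hi => (C.ahead i hi).map g, fun i j hij hj q hi hq => ?_⟩
  rw [mem_edge_map] at hi hq
  simpa only [Function.comp_apply, g.symm_apply_eq] using C.simple i j hij hj _ hi hq

theorem vertex_lt_iff (C : IsSimpleChain h n v) (H : IsHeadingSeq h n) {i : ℕ} (hi : i ≤ n) :
    ((0 < (h i).1 ↔ (v i).1 < (v (i + 1)).1) ∧ ((h i).1 < 0 ↔ (v (i + 1)).1 < (v i).1)) ∧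
      ((0 < (h i).2 ↔ (v i).2 < (v (i + 1)).2) ∧ ((h i).2 < 0 ↔ (v (i + 1)).2 < (v i).2)) :=
  (ahead_iff_lt (H.unit i hi)).1 (C.ahead i hi)

theorem succ_ne (C : IsSimpleChain h n v) (H : IsHeadingSeq h n) {i : ℕ} (hi : i ≤ n) :
    v (i + 1) ≠ v i := by
  have hu := H.unit i hi
  have ha := C.vertex_lt_iff H hi
  intro e
  simp only [gridNorm, e] at *
  omega

theorem end_notMem_edge (C : IsSimpleChain h n v) (H : IsHeadingSeq h n) {i : ℕ} (hi : i < n) :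
    v (n + 1) ∉ edge v i := fun hmem =>
  C.succ_ne H le_rfl (C.simple i n hi le_rfl _ hmem Set.right_mem_uIcc).2

theorem double (C : IsSimpleChain h n v) (H : IsHeadingSeq h n) :
    IsSimpleChain h n (fun i => 2 • v i) := by
  refine C.of_mapsTo_edge H (by simp [C.zero]) (fun i hi => ?_) (fun q => (q.1 / 2, q.2 / 2))
    fun i _ q hq => ?_
  · obtain ⟨l, hl, e⟩ := C.ahead i hi
    exact ⟨2 * l, by omega, by rw [e, smul_add, mul_smul]⟩
  · simp only [mem_edge, two_smul, Prod.fst_add, Prod.snd_add] at *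
    omega

theorem mem_chainEnds_of_mem_edge (C : IsSimpleChain h n v) (H : IsHeadingSeq h n)
    (hp : p ∈ edge v n) (hne : p ≠ v n) : p ∈ chainEnds h n := by
  refine ⟨Function.update v (n + 1) p, C.of_mapsTo_edge H ?_ (fun i hi => ?_) id fun i hi => ?_,
    Function.update_self ..⟩
  · rw [Function.update_of_ne (by omega), C.zero]
  · obtain rfl | hlt := hi.eq_or_lt
    · have hu := H.unit i hi
      have ha := C.vertex_lt_iff H hi
      rw [Function.update_of_ne (by omega), Function.update_self, ahead_iff_lt hu]
      simp only [mem_edge, gridNorm, ne_eq, Prod.ext_iff] at *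
      omega
    · rw [Function.update_of_ne (by omega), Function.update_of_ne (by omega)]
      exact C.ahead i hi
  · obtain rfl | hlt := hi.eq_or_lt
    · rw [edge_update_self]
      exact Set.uIcc_subset_uIcc_left hp
    · rw [edge_update_of_lt hlt]
      exact Set.mapsTo_id _

theorem add_heading_mem_chainEnds (C : IsSimpleChain h n v) (H : IsHeadingSeq h (n + 1))
    (hfree : ∀ i ≤ n, v (n + 1) + h (n + 1) ∉ edge v i) :
    v (n + 1) + h (n + 1) ∈ chainEnds h (n + 1) := by
  set p := v (n + 1) + h (n + 1) with hp
  refine ⟨Function.update v (n + 2) p, .of_disjoint H ?_ (fun i hi => ?_) (fun i j hij hj => ?_),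
    Function.update_self ..⟩
  · rw [Function.update_of_ne (by omega), C.zero]
  · obtain rfl | hlt := hi.eq_or_lt
    · rw [Function.update_of_ne (by omega), Function.update_self]
      exact ⟨1, one_pos, by rw [one_smul]⟩
    · rw [Function.update_of_ne (by omega), Function.update_of_ne (by omega)]
      exact C.ahead i (by omega)
  · rw [edge_update_of_lt (by omega), Set.disjoint_left]
    intro q hi hq
    obtain rfl | hlt := hj.eq_or_lt
    · have hu := H.unit (n + 1) le_rfl
      have hq' : q = v (n + 1) ∨ q = p := by
        rw [edge_update_self, mem_uIcc_iff_coord] at hq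
        simp only [gridNorm, hp, Prod.ext_iff, Prod.fst_add, Prod.snd_add] at *
        omega
      rcases hq' with rfl | rfl
      · exact C.end_notMem_edge H.of_succ (by omega) hi
      · exact hfree i (by omega) hi
    · rw [edge_update_of_lt hlt] at hq
      have := (C.simple i j (by omega) (by omega) q hi hq).1
      omega

end IsSimpleChain

theorem IsGridIsometry.map_mem_chainEnds_iff {g : ℤ × ℤ ≃+ ℤ × ℤ} (hg : IsGridIsometry g) :
    g p ∈ chainEnds (g ∘ h) n ↔ p ∈ chainEnds h n := by
  refine ⟨fun ⟨v, C, e⟩ => ⟨g.symm ∘ v, ?_, by simp [e]⟩, fun ⟨v, C, e⟩ =>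
    ⟨g ∘ v, C.map hg, by simp [e]⟩⟩
  simpa [← Function.comp_assoc] using C.map hg.symm

theorem mem_chainEnds_zero_iff (H : IsHeadingSeq h 0) : p ∈ chainEnds h 0 ↔ Ahead (h 0) 0 p := by
  refine ⟨fun ⟨v, C, e⟩ => by simpa [C.zero, e] using C.ahead 0 le_rfl, fun hp => ?_⟩
  refine ⟨fun i => if i = 0 then 0 else p, .of_disjoint H rfl (fun i hi => ?_) ?_, rfl⟩
  · obtain rfl := Nat.le_zero.1 hi
    exact hp
  · omega

theorem zero_notMem_chainEnds (H : IsHeadingSeq h n) : 0 ∉ chainEnds h n := by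
  rintro ⟨v, C, e⟩
  rcases Nat.eq_zero_or_pos n with rfl | hn
  · exact C.succ_ne H le_rfl (e.trans C.zero.symm)
  · refine C.end_notMem_edge H hn ?_
    rw [e, ← C.zero]
    exact Set.left_mem_uIcc

end Chains

section Stretching

variable {h v : ℕ → ℤ × ℤ} {n : ℕ} {c : ℤ → ℤ} {x y k : ℤ}

/-- Cut the plane along the staircase that separates, at height `y`, the abscissas below `c y` from
the others, and move the right part one step to the right. -/
def stretchRight (c : ℤ → ℤ) (q : ℤ × ℤ) : ℤ × ℤ := (if c q.2 ≤ q.1 then q.1 + 1 else q.1, q.2)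

/-- The monotone map that collapses the gap opened by `stretchRight`. -/
def collapseRight (c : ℤ → ℤ) (q : ℤ × ℤ) : ℤ × ℤ := (if c q.2 < q.1 then q.1 - 1 else q.1, q.2)

/-- A staircase along which a chain can be stretched: it leaves the origin on its left and cuts no
vertical edge of the chain. -/
structure IsCut (v : ℕ → ℤ × ℤ) (n : ℕ) (c : ℤ → ℤ) : Prop where
  pos : 0 < c 0
  side : ∀ i ≤ n, ∀ a ∈ edge v i, ∀ b ∈ edge v i, a.1 = b.1 → (c a.2 ≤ a.1 ↔ c b.2 ≤ b.1)

theorem IsCut.mapsTo_collapseRight (hc : IsCut v n c) (C : IsSimpleChain h n v)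
    (H : IsHeadingSeq h n) {i : ℕ} (hi : i ≤ n) :
    Set.MapsTo (collapseRight c) (edge (stretchRight c ∘ v) i) (edge v i) := by
  intro q hq
  have hu := H.unit i hi
  have ha := C.vertex_lt_iff H hi
  have hl : v i ∈ edge v i := Set.left_mem_uIcc
  have hr : v (i + 1) ∈ edge v i := Set.right_mem_uIcc
  by_cases hvert : (v i).1 = (v (i + 1)).1
  · have hends := hc.side i hi _ hl _ hr hvert
    have hmem : ((v i).1, q.2) ∈ edge v i := by
      simp only [mem_edge, Function.comp_apply, stretchRight] at *
      omega
    have hside := hc.side i hi _ hl _ hmem rfl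
    simp only [mem_edge, Function.comp_apply, stretchRight, collapseRight] at *
    split_ifs at * <;> omega
  · have hhor : (v i).2 = q.2 ∧ (v (i + 1)).2 = q.2 := by
      simp only [gridNorm, mem_edge, Function.comp_apply, stretchRight] at hu hq
      omega
    simp only [mem_edge, Function.comp_apply, stretchRight, collapseRight, hhor.1, hhor.2] at hq ⊢
    split_ifs at * <;> omega

theorem IsCut.isSimpleChain_stretchRight (hc : IsCut v n c) (C : IsSimpleChain h n v)
    (H : IsHeadingSeq h n) : IsSimpleChain h n (stretchRight c ∘ v) := by
  refine C.of_mapsTo_edge H ?_ (fun i hi => ?_) (collapseRight c)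
    fun i hi => hc.mapsTo_collapseRight C H hi
  · simp [C.zero, stretchRight, hc.pos.not_ge]
  · have hu := H.unit i hi
    have ha := C.vertex_lt_iff H hi
    have hends := hc.side i hi _ Set.left_mem_uIcc _ Set.right_mem_uIcc
    simp only [ahead_iff_lt hu, Function.comp_apply, stretchRight]
    by_cases hhor : (v i).2 = (v (i + 1)).2
    · rw [← hhor]
      split_ifs <;> omega
    · simp only [gridNorm] at hu
      split_ifs <;> omega

theorem mk_add_one_mem_chainEnds_of_pos (H : IsHeadingSeq h n) (hp : (x, y) ∈ chainEnds h n)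
    (hx : 0 < x) : (x + 1, y) ∈ chainEnds h n := by
  obtain ⟨v, C, hv⟩ := hp
  have hc : IsCut v n fun _ => 1 := ⟨one_pos, fun _ _ a _ b _ hab => by rw [hab]⟩
  exact ⟨_, hc.isSimpleChain_stretchRight C H, by simp [hv, stretchRight, show 1 ≤ x from hx]⟩

-- The gap starts where the first edge leaves the axis: simplicity keeps the later edges off it.
theorem IsSimpleChain.exists_axis_gap (C : IsSimpleChain h n v) (H : IsHeadingSeq h n)
    (hn : 1 ≤ n) (hv : v (n + 1) = (0, k)) (hk : 0 < k) :
    ∃ m, 0 ≤ m ∧ m < k ∧ ∀ i ≤ n, (0, m) ∈ edge v i → (0, m + 1) ∉ edge v i := by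
  have ha := C.vertex_lt_iff H (Nat.zero_le n)
  have hfirst (y : ℤ) (hy : 0 ≤ y) : (0, y) ∈ edge v 0 ↔ y ≤ max 0 (v 1).2 := by
    have := H.unit 0 (by omega)
    simp only [gridNorm, zero_add, mem_edge, C.zero, Prod.fst_zero, Prod.snd_zero] at *
    omega
  set m : ℤ := max 0 (v 1).2
  have hm0 : (0, m) ∈ edge v 0 := (hfirst m (by omega)).2 le_rfl
  refine ⟨m, by omega, ?_, fun i hi hmi hmi' => ?_⟩
  · by_contra! hkm
    exact C.end_notMem_edge H hn (hv ▸ (hfirst k hk.le).2 hkm)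
  · obtain rfl | hpos := Nat.eq_zero_or_pos i
    · have := (hfirst (m + 1) (by omega)).1 hmi'
      omega
    · obtain ⟨rfl, e⟩ := C.simple 0 i hpos hi _ hm0 hmi
      have ht := H.fst_eq_zero_iff (i := 0) (by omega)
      have hu' := H.unit 1 hi
      have ha' := C.vertex_lt_iff H hi
      simp only [gridNorm, Prod.ext_iff, mem_edge, C.zero, Prod.fst_zero, Prod.snd_zero,
        zero_add] at *
      omega

theorem IsSimpleChain.exists_isCut (C : IsSimpleChain h n v) (H : IsHeadingSeq h n)
    (hn : 1 ≤ n) (hv : v (n + 1) = (0, k)) (hk : 0 < k) : ∃ c, IsCut v n c ∧ c k = 0 := by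
  obtain ⟨m, hm, hmk, hgap⟩ := C.exists_axis_gap H hn hv hk
  refine ⟨fun y => if m < y then 0 else 1, ⟨by simp [not_lt.2 hm], fun i hi a ha b hb hab => ?_⟩,
    if_pos hmk⟩
  have hside : (m < a.2 ↔ m < b.2) ∨ a.1 ≠ 0 := by
    by_contra! hcross
    rw [mem_edge] at ha hb
    exact hgap i hi (mem_edge.2 (by omega)) (mem_edge.2 (by omega))
  split_ifs <;> omega

theorem mk_one_mem_chainEnds_of_mk_zero_mem (H : IsHeadingSeq h n) (hn : 1 ≤ n) (hk : 0 < k)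
    (hp : (0, k) ∈ chainEnds h n) : (1, k) ∈ chainEnds h n := by
  obtain ⟨v, C, hv⟩ := hp
  obtain ⟨c, hc, hck⟩ := C.exists_isCut H hn hv hk
  exact ⟨_, hc.isSimpleChain_stretchRight C H, by simp [hv, stretchRight, hck]⟩

-- Stretch the chain near its end, then return to the axis with a unit segment.
theorem mk_zero_mem_chainEnds_succ (H : IsHeadingSeq h (n + 1)) (hn : 1 ≤ n)
    (hd : h (n + 1) = (-1, 0)) (hk : 0 < k) (hp : (0, k) ∈ chainEnds h n) :
    (0, k) ∈ chainEnds h (n + 1) := by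
  obtain ⟨v, C, hv⟩ := hp
  obtain ⟨c, hc, hck⟩ := C.exists_isCut H.of_succ hn hv hk
  have hend : (stretchRight c ∘ v) (n + 1) = (1, k) := by simp [hv, stretchRight, hck]
  have happ : (stretchRight c ∘ v) (n + 1) + h (n + 1) = (0, k) := by rw [hend, hd]; simp
  rw [← happ]
  refine (hc.isSimpleChain_stretchRight C H.of_succ).add_heading_mem_chainEnds H fun i hi hmem => ?_
  rw [happ] at hmem
  have hmem' : v (n + 1) ∈ edge v i := by
    simpa [collapseRight, hck, hv] using hc.mapsTo_collapseRight C H.of_succ hi hmem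
  obtain rfl | hlt := hi.eq_or_lt
  · have ht := H.fst_eq_zero_iff (Nat.lt_succ_self i)
    have ha := (hc.isSimpleChain_stretchRight C H.of_succ).vertex_lt_iff H.of_succ le_rfl
    simp only [mem_edge, hend, hd] at *
    omega
  · exact C.end_notMem_edge H.of_succ hlt hmem'

end Stretching

section Ends

variable {h : ℕ → ℤ × ℤ} {n : ℕ} {p q d : ℤ × ℤ}

theorem add_mem_chainEnds_of_gridNorm_lt (H : IsHeadingSeq h n) (hn : 1 ≤ n)
    (hp : p ∈ chainEnds h n) (hd : gridNorm d = 1) (hlt : gridNorm p < gridNorm (p + d)) :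
    p + d ∈ chainEnds h n := by
  obtain ⟨g, hg, hgd, hy⟩ := exists_isGridIsometry_map_eq_east hd p
  rw [← hg.map_mem_chainEnds_iff] at hp ⊢
  rw [← hg p, ← hg (p + d), map_add, hgd] at hlt
  rw [map_add, hgd]
  generalize g p = r at hp hlt hy ⊢
  obtain ⟨x, y⟩ := r
  have hx : 0 ≤ x := by
    simp only [gridNorm, Prod.mk_add_mk] at hlt
    omega
  rw [Prod.mk_add_mk, add_zero]
  obtain rfl | hx := hx.eq_or_lt
  · have hy' : 0 < y := by
      refine hy.lt_of_ne fun (e : 0 = y) => zero_notMem_chainEnds (H.map hg) ?_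
      rwa [← e] at hp
    exact mk_one_mem_chainEnds_of_mk_zero_mem (H.map hg) hn hy' hp
  · exact mk_add_one_mem_chainEnds_of_pos (H.map hg) hp hx

theorem mem_chainEnds_of_mem_uIcc (H : IsHeadingSeq h n) (hn : 1 ≤ n) (hp : p ∈ chainEnds h n)
    (hpq : p ∈ Set.uIcc 0 q) : q ∈ chainEnds h n := by
  refine uIcc_grid_induction hp fun a b ha hb hab hmem => ?_
  rw [gridGraph_adj_iff] at hab
  rw [← add_sub_cancel a b]
  refine add_mem_chainEnds_of_gridNorm_lt H hn hmem hab ?_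
  rw [add_sub_cancel]
  simp only [gridNorm, mem_uIcc_iff_coord, Prod.fst_sub, Prod.snd_sub, Prod.fst_zero,
    Prod.snd_zero] at *
  omega

theorem gridJoinedIn_chainEnds_of_mem_uIcc (H : IsHeadingSeq h n) (hn : 1 ≤ n)
    (hp : p ∈ chainEnds h n) (hpq : p ∈ Set.uIcc 0 q) : GridJoinedIn (chainEnds h n) p q := by
  refine .of_uIcc_subset fun r hr => mem_chainEnds_of_mem_uIcc H hn hp ?_
  simp only [mem_uIcc_iff_coord] at *
  omega

theorem mem_chainEnds_succ_of_gridNorm_lt (H : IsHeadingSeq h (n + 1)) (hn : 1 ≤ n)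
    (hp : p ∈ chainEnds h n) (hadd : gridNorm p < gridNorm (p + h (n + 1)))
    (hsub : gridNorm p < gridNorm (p - h (n + 1))) : p ∈ chainEnds h (n + 1) := by
  have hu : gridNorm (-h (n + 1)) = 1 := by simpa [gridNorm] using H.unit (n + 1) le_rfl
  obtain ⟨g, hg, hgd, hy⟩ := exists_isGridIsometry_map_eq_east hu p
  have hgd' : (g ∘ h) (n + 1) = (-1, 0) := by
    rw [Function.comp_apply, ← neg_neg (g _), ← map_neg, hgd]
    rfl
  rw [← hg.map_mem_chainEnds_iff] at hp ⊢
  rw [← hg p, ← hg (p + _), map_add, ← Function.comp_apply (f := g), hgd'] at hadd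
  rw [← hg p, ← hg (p - _), map_sub, ← Function.comp_apply (f := g), hgd'] at hsub
  generalize g p = r at hp hadd hsub hy ⊢
  obtain ⟨x, y⟩ := r
  obtain rfl : x = 0 := by
    simp only [gridNorm, Prod.mk_add_mk, Prod.mk_sub_mk] at hadd hsub
    omega
  have hy' : 0 < y := by
    refine hy.lt_of_ne fun (e : 0 = y) => zero_notMem_chainEnds (H.of_succ.map hg) ?_
    rwa [← e] at hp
  exact mk_zero_mem_chainEnds_succ (H.map hg) hn hgd' hy' hp

-- Doubling makes room for one more unit segment: the new end has an odd coordinate in the direction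
-- of that segment, so an edge through it is parallel to the segment and also contains its start.
theorem two_smul_add_mem_chainEnds_succ (H : IsHeadingSeq h (n + 1)) (hp : p ∈ chainEnds h n) :
    2 • p + h (n + 1) ∈ chainEnds h (n + 1) := by
  obtain ⟨v, C, rfl⟩ := hp
  refine (C.double H.of_succ).add_heading_mem_chainEnds H fun i hi hmem => ?_
  have hu := H.unit i (by omega)
  have hu' := H.unit (n + 1) le_rfl
  have ha := C.vertex_lt_iff H.of_succ hi
  have hpar : v (n + 1) ∈ edge v i ∧ ((h i).1 = 0 ↔ (h (n + 1)).1 = 0) := by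
    simp only [mem_edge, gridNorm, two_smul, Prod.fst_add, Prod.snd_add] at *
    omega
  obtain rfl | hlt := hi.eq_or_lt
  · have := H.fst_eq_zero_iff (Nat.lt_succ_self i)
    omega
  · exact C.end_notMem_edge H.of_succ hlt hpar.1

end Ends

section Connectedness

variable {h v : ℕ → ℤ × ℤ} {n : ℕ} {p q d : ℤ × ℤ}

theorem IsSimpleChain.gridJoinedIn_last_edge (C : IsSimpleChain h n v) (H : IsHeadingSeq h n) :
    GridJoinedIn (chainEnds h n) (v n + h n) (v (n + 1)) := by
  have hu := H.unit n le_rfl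
  have ha := C.vertex_lt_iff H le_rfl
  refine .of_uIcc_subset fun r hr => C.mem_chainEnds_of_mem_edge H ?_ ?_ <;>
    simp only [mem_edge, mem_uIcc_iff_coord, gridNorm, ne_eq, Prod.ext_iff, Prod.fst_add,
      Prod.snd_add] at * <;> omega

theorem exists_gridJoinedIn_two_smul_add (H : IsHeadingSeq h (n + 1))
    (hp : p ∈ chainEnds h (n + 1)) :
    ∃ q ∈ chainEnds h n, GridJoinedIn (chainEnds h (n + 1)) (2 • q + h (n + 1)) p := by
  obtain ⟨v, C, rfl⟩ := hp
  have hu := H.unit (n + 1) le_rfl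
  have hfirst := C.gridJoinedIn_last_edge H
  have hout := gridJoinedIn_chainEnds_of_mem_uIcc (q := 2 • v (n + 1) + h (n + 1)) H (by omega)
    hfirst.1 (by
      simp only [mem_uIcc_iff_coord, gridNorm, two_smul, Prod.fst_add, Prod.snd_add,
        Prod.fst_zero, Prod.snd_zero] at *
      omega)
  exact ⟨v (n + 1), ⟨v, C.of_succ, rfl⟩, hout.symm.trans hfirst⟩

theorem two_smul_add_mem_uIcc_or_eq_sub (hd : gridNorm d = 1) (hpq : gridNorm (q - p) = 1)
    (hlt : gridNorm p < gridNorm q) :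
    2 • p + d ∈ Set.uIcc 0 (2 • q + d) ∨ q = p - d ∧ gridNorm p < gridNorm (p + d) := by
  rcases gridNorm_eq_one_iff.1 hd with rfl | rfl | rfl | rfl <;>
    simp only [mem_uIcc_iff_coord, gridNorm, two_smul, Prod.ext_iff, Prod.fst_add, Prod.snd_add,
      Prod.fst_sub, Prod.snd_sub, Prod.fst_zero, Prod.snd_zero] at * <;> omega

theorem one_le_of_mem_chainEnds_of_sub_mem (H : IsHeadingSeq h (n + 1)) (hp : p ∈ chainEnds h n)
    (hq : p - h (n + 1) ∈ chainEnds h n) : 1 ≤ n := by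
  refine Nat.one_le_iff_ne_zero.2 ?_
  rintro rfl
  have hu := H.unit 0 (by omega)
  have hu' := H.unit 1 le_rfl
  have ht := H.fst_eq_zero_iff (Nat.lt_succ_self 0)
  rw [mem_chainEnds_zero_iff H.of_succ, ahead_iff_lt hu] at hp hq
  simp only [gridNorm, Prod.fst_sub, Prod.snd_sub, Prod.fst_zero, Prod.snd_zero,
    zero_add] at *
  omega

theorem gridJoinedIn_two_smul_add_of_lt (H : IsHeadingSeq h (n + 1)) (hp : p ∈ chainEnds h n)
    (hq : q ∈ chainEnds h n) (hpq : gridNorm (q - p) = 1) (hlt : gridNorm p < gridNorm q) :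
    GridJoinedIn (chainEnds h (n + 1)) (2 • p + h (n + 1)) (2 • q + h (n + 1)) := by
  have hu := H.unit (n + 1) le_rfl
  rcases two_smul_add_mem_uIcc_or_eq_sub hu hpq hlt with hmem | ⟨rfl, hadd⟩
  · exact gridJoinedIn_chainEnds_of_mem_uIcc H (by omega)
      (two_smul_add_mem_chainEnds_succ H hp) hmem
  -- Now `2 • p` lies between the two points, and both are reached from `p` by moving outwards.
  have hp' : p ∈ chainEnds h (n + 1) :=
    mem_chainEnds_succ_of_gridNorm_lt H (one_le_of_mem_chainEnds_of_sub_mem H hp hq) hp hadd hlt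
  refine (gridJoinedIn_chainEnds_of_mem_uIcc H (by omega) hp' ?_).symm.trans
    (gridJoinedIn_chainEnds_of_mem_uIcc H (by omega) hp' ?_) <;>
    simp only [mem_uIcc_iff_coord, gridNorm, two_smul, Prod.fst_add, Prod.snd_add, Prod.fst_sub,
      Prod.snd_sub, Prod.fst_zero, Prod.snd_zero] at * <;> omega

theorem gridJoinedIn_two_smul_add_of_adj (H : IsHeadingSeq h (n + 1)) (hp : p ∈ chainEnds h n)
    (hq : q ∈ chainEnds h n) (hpq : gridGraph.Adj p q) :
    GridJoinedIn (chainEnds h (n + 1)) (2 • p + h (n + 1)) (2 • q + h (n + 1)) := by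
  have hne : gridNorm p ≠ gridNorm q := by
    simp only [gridGraph_adj_iff, gridNorm, Prod.fst_sub, Prod.snd_sub] at *
    omega
  rcases hne.lt_or_gt with hlt | hlt
  · exact gridJoinedIn_two_smul_add_of_lt H hp hq (gridGraph_adj_iff.1 hpq) hlt
  · exact (gridJoinedIn_two_smul_add_of_lt H hq hp (gridGraph_adj_iff.1 hpq.symm) hlt).symm

theorem gridConnected_chainEnds (H : IsHeadingSeq h n) : GridConnected (chainEnds h n) := by
  rw [gridConnected_iff_exists_gridJoinedIn]
  induction n with
  | zero =>
    refine ⟨h 0, (mem_chainEnds_zero_iff H).2 ⟨1, one_pos, by simp⟩, ?_⟩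
    rintro p ⟨v, C, rfl⟩
    simpa [C.zero] using C.gridJoinedIn_last_edge H
  | succ n ih =>
    obtain ⟨o, ho, hjoin⟩ := ih H.of_succ
    refine ⟨2 • o + h (n + 1), two_smul_add_mem_chainEnds_succ H ho, fun p hp => ?_⟩
    obtain ⟨q, hq, hqp⟩ := exists_gridJoinedIn_two_smul_add H hp
    exact .trans (.map (f := fun q => 2 • q + h (n + 1))
      (fun _ => two_smul_add_mem_chainEnds_succ H)
      (fun _ ha _ hb => gridJoinedIn_two_smul_add_of_adj H ha hb) (hjoin q hq)) hqp

theorem gridConnected_compl_setOf_ahead (hd : gridNorm d = 1) :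
    GridConnected {p | Ahead d 0 p}ᶜ := by
  rw [gridConnected_iff_exists_gridJoinedIn]
  simp only [ahead_iff_lt hd, Prod.fst_zero, Prod.snd_zero]
  refine ⟨0, by simp [gridNorm] at *; omega, fun p hp => ?_⟩
  -- Pass through the orthogonal projection of `p` to the line perpendicular to the ray.
  refine .trans (b := if d.1 = 0 then (p.1, 0) else (0, p.2)) (.of_uIcc_subset fun q hq => ?_)
    (.of_uIcc_subset fun q hq => ?_) <;>
    simp only [gridNorm, mem_uIcc_iff_coord, Set.mem_compl_iff, Set.mem_ofPred_eq, Prod.fst_zero,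
      Prod.snd_zero] at * <;>
    split_ifs at * <;> dsimp only at * <;> omega

theorem gridConnected_compl_chainEnds (H : IsHeadingSeq h n) :
    GridConnected (chainEnds h n)ᶜ := by
  obtain rfl | hn := Nat.eq_zero_or_pos n
  · rw [show chainEnds h 0 = {p | Ahead (h 0) 0 p} from Set.ext fun _ => mem_chainEnds_zero_iff H]
    exact gridConnected_compl_setOf_ahead (H.unit 0 le_rfl)
  · refine gridConnected_iff_exists_gridJoinedIn.2 ⟨0, zero_notMem_chainEnds H, fun p hp => ?_⟩
    refine .of_uIcc_subset fun q hq hmem => hp (mem_chainEnds_of_mem_uIcc H hn hmem hq)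

end Connectedness

section Reachability

variable {σ : List Turn}

theorem heading_succ {i : ℕ} (hi : i < σ.length) :
    heading σ (i + 1) = (σ[i]).apply (heading σ i) := by
  rw [heading, heading, List.take_add_one, List.getElem?_eq_getElem hi, List.foldl_append]
  rfl

theorem gridNorm_turn_apply (t : Turn) (d : ℤ × ℤ) : gridNorm (t.apply d) = gridNorm d := by
  cases t <;> simp [gridNorm, Turn.apply, add_comm]

theorem isHeadingSeq_heading (σ : List Turn) : IsHeadingSeq (heading σ) σ.length := by
  have hunit (i : ℕ) (hi : i ≤ σ.length) : gridNorm (heading σ i) = 1 := by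
    induction i with
    | zero => simp [heading, gridNorm]
    | succ i ih => rw [heading_succ hi, gridNorm_turn_apply, ih (by omega)]
  refine ⟨hunit, fun i hi => ?_⟩
  have hu := hunit i hi.le
  rw [heading_succ hi]
  cases σ[i] <;>
    simp only [gridNorm, Turn.apply, ne_eq, Prod.ext_iff, Prod.fst_neg, Prod.snd_neg] at * <;> omega

theorem chainVertex_succ (σ : List Turn) (ℓ : ℕ → ℕ) (i : ℕ) :
    chainVertex σ ℓ (i + 1) = chainVertex σ ℓ i + ℓ i • heading σ i :=
  Finset.sum_range_succ _ _

theorem Realizes.isSimpleChain {ℓ : ℕ → ℕ} (hℓ : Realizes σ ℓ) :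
    IsSimpleChain (heading σ) σ.length (chainVertex σ ℓ) :=
  ⟨rfl, fun i hi => ⟨ℓ i, hℓ.1 i hi, chainVertex_succ σ ℓ i⟩, hℓ.2⟩

theorem reachableSet_eq_chainEnds (σ : List Turn) :
    reachableSet σ = chainEnds (heading σ) σ.length := by
  ext p
  constructor
  · rintro ⟨ℓ, hℓ, rfl⟩
    exact ⟨_, hℓ.isSimpleChain, rfl⟩
  · rintro ⟨v, C, rfl⟩
    choose! ℓ hpos hv using C.ahead
    have hvertex (i : ℕ) (hi : i ≤ σ.length + 1) : chainVertex σ ℓ i = v i := by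
      induction i with
      | zero => exact C.zero.symm
      | succ i ih => rw [chainVertex_succ, ih (by omega), ← hv i (by omega)]
    refine ⟨ℓ, ⟨hpos, fun i j hij hj q => ?_⟩, hvertex _ le_rfl⟩
    rw [chainSegment, chainSegment, hvertex i (by omega), hvertex (i + 1) (by omega),
      hvertex j (by omega), hvertex (j + 1) (by omega)]
    exact C.simple i j hij hj q

end Reachability

theorem theorem2 (σ : List Turn) :
    GridConnected (reachableSet σ) ∧ GridConnected (reachableSet σ)ᶜ := by
  rw [reachableSet_eq_chainEnds]
  exact ⟨gridConnected_chainEnds (isHeadingSeq_heading σ),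
    gridConnected_compl_chainEnds (isHeadingSeq_heading σ)⟩
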